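/- Let $G$ be a Lie group with Lie algebra $\mathfrak g=T_eG$ and let $\tau:P\to M$ be a smooth principal $G$-bundle with right action $R_g(p)=p\cdot g$. For $p\in P$ let $V_pP=\ker T_p\tau$ be the vertical space, identified with $\mathfrak g$ through the isomorphism $\mathfrak g\to V_pP$, $\xi\mapsto \frac{d}{dt}\big|_{t=0}\,p\cdot\exp(t\xi)$. Let $$J^1P=\bigcup_{p\in P}\{\rho:T_{\tau(p)}M\to T_pP \text{ linear} \;:\; T_p\tau\circ\rho=\mathrm{id}\}$$ be the first jet bundle, with its standard smooth structure, with projection $\tau_{10}:J^1P\to P$ sending $\rho$ to its base point $p$, and with the right $G$-action $\rho\cdot g=T_pR_g\circ\rho$. The canonical form $\omega\in\Omega^1(J^1P,\mathfrak g)$ is given by $$\omega|_\rho(Y)=(\mathrm{id}-\rho\circ T_p\tau)\bigl(T_\rho\tau_{10}(Y)\bigr)\in V_pP\simeq\mathfrak g,\qquad p=\tau_{10}(\rho),\ Y\in T_\rho J^1P .$$ Let $C(P)=J^1P/G$ be the bundle of connections, with projection $\pi:C(P)\to M$, $\pi([\rho]_G)=\tau(\tau_{10}(\rho))$, and identify $J^1P$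 with the pullback $\pi^*P=\{(c,u)\in C(P)\times P:\pi(c)=\tau(u)\}$ through the bijection $\rho\mapsto([\rho]_G,\tau_{10}(\rho))$. Let $\Gamma$ be a connection on $P$, that is, a smooth family of linear projections $\Gamma_p:T_pP\to V_pP$ onto the vertical spaces with $\Gamma_{p\cdot g}\circ T_pR_g=T_pR_g\circ\Gamma_p$ for all $p\in P$, $g\in G$. Let $\omega_\Gamma\in\Omega^1(P,\mathfrak g)$ be its connection form, $\omega_\Gamma|_p(X)=\Gamma_p(X)\in V_pP\simeq\mathfrak g$. Let $\sigma_\Gamma:M\to C(P)$ be the section with $\sigma_\Gamma(m)=[\rho]_G$, where $\rho$ is a jet at some $p\in\tau^{-1}(m)$ with $\mathrm{id}-\rho\circ T_p\tau=\Gamma_p$, and let $\tilde\sigma_\Gamma:P\to J^1P\simeq\pi^*P$ be the map $\tilde\sigma_\Gamma(u)=(\sigma_\Gamma(\tau(u)),u)$. Then $\tilde\sigma_\Gamma$ is a smooth section of $\tau_{10}:J^1P\to P$, and $$\tilde\sigma_\Gamma^*\,\omega=\omega_\Gamma .$$ -/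

import Mathlib

open Bundle Set Filter
open scoped Manifold ContDiff Topology Bundle

noncomputable section

set_option linter.unusedSectionVars false

section TangentCongr

variable {E H X : Type*} [NormedAddCommGroup E] [NormedSpace ℝ E] [TopologicalSpace H]
  (I : ModelWithCorners ℝ E H) [TopologicalSpace X] [ChartedSpace H X]

/-- The identification of the tangent spaces at two equal points. -/
def tangentCongr {x y : X} (h : x = y) : TangentSpace I x ≃L[ℝ] TangentSpace I y :=
  h ▸ ContinuousLinearEquiv.refl ℝ (TangentSpace I x)

theorem tangentCongr_rfl {x : X} (v : TangentSpace I x) : tangentCongr I (rfl : x = x) v = v := rfl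

theorem tangentCongr_trans {x y z : X} (h : x = y) (h' : y = z) (v : TangentSpace I x) :
    tangentCongr I h' (tangentCongr I h v) = tangentCongr I (h.trans h') v := by
  subst h; subst h'; rfl

theorem tangentCongr_eq {x y : X} (h : x = y) (v : TangentSpace I x) :
    (tangentCongr I h v : E) = (v : E) := by
  subst h; rfl

variable {I}
variable {E' H' Y : Type*} [NormedAddCommGroup E'] [NormedSpace ℝ E'] [TopologicalSpace H']
  {J : ModelWithCorners ℝ E' H'} [TopologicalSpace Y] [ChartedSpace H' Y]
  {E'' H'' Z : Type*} [NormedAddCommGroup E''] [NormedSpace ℝ E''] [TopologicalSpace H'']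
  {K : ModelWithCorners ℝ E'' H''} [TopologicalSpace Z] [ChartedSpace H'' Z]

/-- The chain rule, up to the identification of tangent spaces at equal points. -/
theorem mfderiv_chain {f : X → Y} {g : Y → Z} {k : X → Z} {x : X} {y : Y} {z : Z}
    (hf : MDifferentiableAt I J f x) (hg : MDifferentiableAt J K g y) (hy : f x = y)
    (hz : g y = z) (hz' : k x = z) (hk : g ∘ f =ᶠ[𝓝 x] k) (v : TangentSpace I x) :
    tangentCongr K hz (mfderiv J K g y (tangentCongr J hy (mfderiv I J f x v))) =
      tangentCongr K hz' (mfderiv I K k x v) := by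
  subst hy
  subst hz
  have h1 : mfderiv I K (g ∘ f) x v = mfderiv J K g (f x) (mfderiv I J f x v) := by
    rw [mfderiv_comp x hg hf]; rfl
  have h2 := hk.mfderiv_eq (I := I) (I' := K)
  have h3 := tangentCongr_eq K hz' (mfderiv I K k x v)
  rw [tangentCongr_rfl, tangentCongr_rfl]
  refine h1.symm.trans (Eq.trans ?_ h3.symm)
  exact DFunLike.congr_fun h2 v

theorem tangentCongr_mfderiv {f g : X → Y} {x : X} {y : Y} (h : f = g) (hf : f x = y)
    (hg : g x = y) (v : TangentSpace I x) :
    tangentCongr J hf (mfderiv I J f x v) = tangentCongr J hg (mfderiv I J g x v) := by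
  subst h; rfl

end TangentCongr

/-- A smooth principal `G`-bundle `P → M`, with right action `act`. -/
structure PrincipalBundle {EM HM EP HP EG HG : Type*}
    [NormedAddCommGroup EM] [NormedSpace ℝ EM] [TopologicalSpace HM]
    [NormedAddCommGroup EP] [NormedSpace ℝ EP] [TopologicalSpace HP]
    [NormedAddCommGroup EG] [NormedSpace ℝ EG] [TopologicalSpace HG]
    (IM : ModelWithCorners ℝ EM HM) (IP : ModelWithCorners ℝ EP HP)
    (IG : ModelWithCorners ℝ EG HG)
    (M P G : Type*) [TopologicalSpace M] [ChartedSpace HM M]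
    [TopologicalSpace P] [ChartedSpace HP P]
    [TopologicalSpace G] [ChartedSpace HG G] [Group G] where
  proj : P → M
  act : P → G → P
  contMDiff_proj : ContMDiff IP IM ∞ proj
  contMDiff_act : ContMDiff (IP.prod IG) IP ∞ (fun x : P × G => act x.1 x.2)
  act_one : ∀ p, act p 1 = p
  act_mul : ∀ p g h, act p (g * h) = act (act p g) h
  act_free : ∀ p g, act p g = p → g = 1
  /-- The fibres of the projection are exactly the orbits. -/
  proj_eq_iff : ∀ p q, proj p = proj q ↔ ∃ g, act p g = q
  /-- Local triviality, through smooth equivariant trivializations. -/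
  exists_triv : ∀ x : M, ∃ t : Trivialization G proj, x ∈ t.baseSet ∧
    ContMDiffOn IP (IM.prod IG) ∞ t t.source ∧
    ContMDiffOn (IM.prod IG) IP ∞ t.toOpenPartialHomeomorph.symm t.target ∧
    ∀ p ∈ t.source, ∀ g, (t (act p g)).2 = (t p).2 * g

namespace PrincipalBundle

variable {EM HM EP HP EG HG : Type*}
  [NormedAddCommGroup EM] [NormedSpace ℝ EM] [TopologicalSpace HM]
  [NormedAddCommGroup EP] [NormedSpace ℝ EP] [TopologicalSpace HP]
  [NormedAddCommGroup EG] [NormedSpace ℝ EG] [TopologicalSpace HG]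
  {IM : ModelWithCorners ℝ EM HM} {IP : ModelWithCorners ℝ EP HP}
  {IG : ModelWithCorners ℝ EG HG}
  {M P G : Type*} [TopologicalSpace M] [ChartedSpace HM M]
  [TopologicalSpace P] [ChartedSpace HP P]
  [TopologicalSpace G] [ChartedSpace HG G] [Group G]
  (B : PrincipalBundle IM IP IG M P G)

/-- The smooth equivariant local trivializations of a principal bundle. -/
structure LocalTriv extends Trivialization G B.proj where
  contMDiffOn_toFun : ContMDiffOn IP (IM.prod IG) ∞ toOpenPartialHomeomorph source
  contMDiffOn_invFun : ContMDiffOn (IM.prod IG) IP ∞ toOpenPartialHomeomorph.symm target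
  equivariant : ∀ p ∈ source, ∀ g,
    (toOpenPartialHomeomorph (B.act p g)).2 = (toOpenPartialHomeomorph p).2 * g

theorem exists_localTriv (x : M) : ∃ t : B.LocalTriv, x ∈ t.baseSet := by
  obtain ⟨t, h, h1, h2, h3⟩ := B.exists_triv x
  exact ⟨⟨t, h1, h2, h3⟩, h⟩

theorem proj_act (p : P) (g : G) : B.proj (B.act p g) = B.proj p :=
  ((B.proj_eq_iff p _).2 ⟨g, rfl⟩).symm

theorem proj_surjective : Function.Surjective B.proj := by
  intro x
  obtain ⟨t, h⟩ := B.exists_localTriv x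
  exact ⟨t.toOpenPartialHomeomorph.symm (x, 1), t.toTrivialization.proj_symm_apply' h⟩

theorem mdifferentiable_proj : MDifferentiable IP IM B.proj :=
  B.contMDiff_proj.mdifferentiable (by simp)

theorem contMDiff_act_right (g : G) : ContMDiff IP IP ∞ (fun p => B.act p g) :=
  B.contMDiff_act.comp (contMDiff_id.prodMk contMDiff_const)

theorem mdifferentiable_act_right (g : G) : MDifferentiable IP IP (fun p => B.act p g) :=
  (B.contMDiff_act_right g).mdifferentiable (by simp)

theorem mdifferentiable_act_left (p : P) : MDifferentiable IG IP (B.act p) :=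
  (B.contMDiff_act.comp (contMDiff_const.prodMk contMDiff_id)).mdifferentiable (by simp)

/-- The infinitesimal action `ξ ↦ d/dt|₀ p · exp (t ξ)`, that is, the derivative at the identity
of the orbit map `g ↦ p · g`. -/
def infAct (p : P) : GroupLieAlgebra IG G →L[ℝ] TangentSpace IP p :=
  (tangentCongr IP (B.act_one p)).toContinuousLinearMap.comp (mfderiv IG IP (B.act p) 1)

/-- The vertical subspace `V_p P`. -/
def vertical (p : P) : Submodule ℝ (TangentSpace IP p) :=
  LinearMap.ker (mfderiv IP IM B.proj p).toLinearMap

variable {B}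

namespace LocalTriv

variable (t : B.LocalTriv)

/-- The group component of a local trivialization. -/
def fib (p : P) : G := (t.toOpenPartialHomeomorph p).2

/-- The local inverse of a local trivialization. -/
def inv (x : M) (g : G) : P := t.toOpenPartialHomeomorph.symm (x, g)

theorem mem_source {p : P} : p ∈ t.source ↔ B.proj p ∈ t.baseSet := t.toTrivialization.mem_source

theorem inv_fib {p : P} (hp : B.proj p ∈ t.baseSet) : t.inv (B.proj p) (t.fib p) = p :=
  t.toTrivialization.symm_apply_mk_proj (t.mem_source.2 hp)

theorem proj_inv {x : M} (hx : x ∈ t.baseSet) (g : G) : B.proj (t.inv x g) = x :=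
  t.toTrivialization.proj_symm_apply' hx

theorem fib_inv {x : M} (hx : x ∈ t.baseSet) (g : G) : t.fib (t.inv x g) = g := by
  have := t.toTrivialization.apply_symm_apply' (x := g) hx
  exact congrArg Prod.snd this

theorem fib_act {p : P} (hp : B.proj p ∈ t.baseSet) (g : G) :
    t.fib (B.act p g) = t.fib p * g := t.equivariant p (t.mem_source.2 hp) g

theorem nhds_base {p : P} (hp : B.proj p ∈ t.baseSet) : ∀ᶠ q in 𝓝 p, B.proj q ∈ t.baseSet :=
  B.contMDiff_proj.continuous.continuousAt (t.open_baseSet.mem_nhds hp)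

theorem contMDiffAt_fib {p : P} (hp : B.proj p ∈ t.baseSet) : ContMDiffAt IP IG ∞ t.fib p :=
  (t.contMDiffOn_toFun.contMDiffAt (t.open_source.mem_nhds (t.mem_source.2 hp))).snd

theorem contMDiffAt_inv {x : M} (hx : x ∈ t.baseSet) (g : G) :
    ContMDiffAt (IM.prod IG) IP ∞ (fun z : M × G => t.inv z.1 z.2) (x, g) :=
  t.contMDiffOn_invFun.contMDiffAt (t.open_target.mem_nhds (t.toTrivialization.mem_target.2 hx))

variable [LieGroup IG ∞ G]

/-- The flat local connection form of a local trivialization: the pullback of the left-invariant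
Maurer-Cartan form by the group component. -/
def flatForm (p : P) : TangentSpace IP p →L[ℝ] GroupLieAlgebra IG G :=
  (tangentCongr IG (inv_mul_cancel (t.fib p))).toContinuousLinearMap.comp
    (mfderiv IP IG (fun q => (t.fib p)⁻¹ * t.fib q) p)

open Classical in
/-- The flat local horizontal lift of a local trivialization: the derivative at `proj p` of the
local section which is constant in the trivialization and passes through `p`. -/
def flatLift (p : P) : TangentSpace IM (B.proj p) →L[ℝ] TangentSpace IP p :=
  if hp : B.proj p ∈ t.baseSet then
    (tangentCongr IP (t.inv_fib hp)).toContinuousLinearMap.comp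
      (mfderiv IM IP (fun x => t.inv x (t.fib p)) (B.proj p))
  else 0

theorem flatLift_apply {p : P} (hp : B.proj p ∈ t.baseSet) (v : TangentSpace IM (B.proj p)) :
    t.flatLift p v = tangentCongr IP (t.inv_fib hp)
      (mfderiv IM IP (fun x => t.inv x (t.fib p)) (B.proj p) v) := by
  simp only [flatLift, dif_pos hp]; rfl

theorem flatForm_apply {p : P} (v : TangentSpace IP p) :
    t.flatForm p v = tangentCongr IG (inv_mul_cancel (t.fib p))
      (mfderiv IP IG (fun q => (t.fib p)⁻¹ * t.fib q) p v) := rfl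

theorem contMDiffAt_flat {p : P} (hp : B.proj p ∈ t.baseSet) (g : G) :
    ContMDiffAt IP IG ∞ (fun q => g⁻¹ * t.fib q) p :=
  (contMDiffAt_const (c := g⁻¹)).mul (t.contMDiffAt_fib hp)

theorem contMDiffAt_inv_left {x : M} (hx : x ∈ t.baseSet) (g : G) :
    ContMDiffAt IM IP ∞ (fun y => t.inv y g) x :=
  (t.contMDiffAt_inv hx g).comp x (contMDiffAt_id.prodMk contMDiffAt_const)

theorem proj_flatLift {p : P} (hp : B.proj p ∈ t.baseSet) (v : TangentSpace IM (B.proj p)) :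
    mfderiv IP IM B.proj p (t.flatLift p v) = v := by
  rw [flatLift_apply t hp]
  have := mfderiv_chain (I := IM) (J := IP) (K := IM) (k := id) (z := B.proj p)
    ((t.contMDiffAt_inv_left hp (t.fib p)).mdifferentiableAt (by simp))
    (B.mdifferentiable_proj p) (t.inv_fib hp) rfl rfl
    (by filter_upwards [t.open_baseSet.mem_nhds hp] with y hy using t.proj_inv hy _) v
  rw [mfderiv_id] at this
  exact this

theorem flatForm_flatLift {p : P} (hp : B.proj p ∈ t.baseSet) (v : TangentSpace IM (B.proj p)) :
    t.flatForm p (t.flatLift p v) = 0 := by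
  rw [flatLift_apply t hp, flatForm_apply]
  rw [mfderiv_chain (I := IM) (J := IP) (K := IG) (k := fun _ => (1 : G)) (z := (1 : G))
    ((t.contMDiffAt_inv_left hp (t.fib p)).mdifferentiableAt (by simp))
    ((t.contMDiffAt_flat hp (t.fib p)).mdifferentiableAt (by simp)) (t.inv_fib hp)
    (inv_mul_cancel _) rfl
    (by filter_upwards [t.open_baseSet.mem_nhds hp] with y hy
        simp [t.fib_inv hy]) v, mfderiv_const]
  rfl

theorem flatForm_infAct {p : P} (hp : B.proj p ∈ t.baseSet) (ξ : GroupLieAlgebra IG G) :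
    t.flatForm p (B.infAct p ξ) = ξ := by
  rw [flatForm_apply]
  have := mfderiv_chain (I := IG) (J := IP) (K := IG) (k := id) (z := (1 : G))
    (B.mdifferentiable_act_left p 1)
    ((t.contMDiffAt_flat hp (t.fib p)).mdifferentiableAt (by simp)) (B.act_one p)
    (inv_mul_cancel _) rfl
    (by filter_upwards with g; simp [t.fib_act hp]) ξ
  rw [mfderiv_id] at this
  exact this

end LocalTriv

variable (B) in
theorem proj_infAct (p : P) (ξ : GroupLieAlgebra IG G) :
    mfderiv IP IM B.proj p (B.infAct p ξ) = 0 := by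
  have := mfderiv_chain (I := IG) (J := IP) (K := IM) (k := fun _ => B.proj p) (z := B.proj p)
    (B.mdifferentiable_act_left p 1)
    (B.mdifferentiable_proj p) (B.act_one p) rfl rfl
    (by filter_upwards with g using B.proj_act p g) ξ
  rw [mfderiv_const] at this
  exact this

namespace LocalTriv
variable (t : B.LocalTriv) [LieGroup IG ∞ G]

theorem decomp {p : P} (hp : B.proj p ∈ t.baseSet) (X : TangentSpace IP p) :
    t.flatLift p (mfderiv IP IM B.proj p X) + B.infAct p (t.flatForm p X) = X := by
  let F : M × G → P := fun z => t.inv z.1 (t.fib p * z.2)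
  let f : P → M × G := fun q => (B.proj q, (t.fib p)⁻¹ * t.fib q)
  have hF : MDifferentiableAt (IM.prod IG) IP F (B.proj p, 1) := by
    have h : ContMDiffAt (IM.prod IG) IP ∞ F (B.proj p, 1) :=
      (t.contMDiffAt_inv hp (t.fib p * 1)).comp (B.proj p, (1 : G))
        (f := fun z : M × G => (z.1, t.fib p * z.2))
        (contMDiffAt_fst.prodMk (contMDiffAt_const.mul contMDiffAt_snd))
    exact h.mdifferentiableAt (by simp)
  have hf1 := B.mdifferentiable_proj p
  have hf2 := (t.contMDiffAt_flat hp (t.fib p)).mdifferentiableAt (n := ∞) (by simp)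
  have hf : MDifferentiableAt IP (IM.prod IG) f p := hf1.prodMk hf2
  have hy : f p = (B.proj p, 1) := by simp [f]
  have hz : F (B.proj p, 1) = p := by simp [F, t.inv_fib hp]
  have key := mfderiv_chain (k := id) hf hF hy hz rfl
    (by filter_upwards [t.nhds_base hp] with q hq; simp [F, f, t.inv_fib hq]) X
  rw [mfderiv_id] at key
  have key' : tangentCongr IP hz (mfderiv (IM.prod IG) IP F (B.proj p, 1)
    (tangentCongr (IM.prod IG) hy (mfderiv IP (IM.prod IG) f p X))) = X := key
  set w := tangentCongr (IM.prod IG) hy (mfderiv IP (IM.prod IG) f p X) with hw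
  have hwE := tangentCongr_eq (IM.prod IG) hy (mfderiv IP (IM.prod IG) f p X)
  have hfd := DFunLike.congr_fun (mfderiv_prodMk hf1 hf2) X
  have h1 : w.1 = mfderiv IP IM B.proj p X := congrArg Prod.fst (hwE.trans hfd)
  have h2 : w.2 = t.flatForm p X :=
    (congrArg Prod.snd (hwE.trans hfd)).trans (tangentCongr_eq IG (inv_mul_cancel (t.fib p))
      (mfderiv IP IG (fun q => (t.fib p)⁻¹ * t.fib q) p X)).symm
  have h3 : tangentCongr IP hz (mfderiv IM IP (fun z => F (z, 1)) (B.proj p)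
      (mfderiv IP IM B.proj p X)) = t.flatLift p (mfderiv IP IM B.proj p X) := by
    rw [flatLift_apply t hp]
    have hfun : (fun z => F (z, 1)) = fun x => t.inv x (t.fib p) := by
      funext z; simp only [F, mul_one]
    exact tangentCongr_mfderiv hfun hz (t.inv_fib hp) _
  have h4 : tangentCongr IP hz (mfderiv IG IP (fun z => F (B.proj p, z)) 1
      (t.flatForm p X)) = B.infAct p (t.flatForm p X) := by
    have hfun : (fun z => F (B.proj p, z)) = B.act p := by
      funext k
      have := t.inv_fib (p := B.act p k) (by rwa [B.proj_act])
      rwa [B.proj_act, t.fib_act hp] at this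
    exact tangentCongr_mfderiv hfun hz (B.act_one p) _
  have h5 := mfderiv_prod_eq_add_apply (v := w) hF
  rw [← h3, ← h4, ← h1, ← h2, ← map_add]
  refine Eq.trans ?_ key'
  exact congrArg (tangentCongr IP hz) h5.symm

end LocalTriv

section Vertical

variable [LieGroup IG ∞ G] (B)

theorem infAct_mem_vertical (p : P) (ξ : GroupLieAlgebra IG G) :
    B.infAct p ξ ∈ B.vertical p := B.proj_infAct p ξ

theorem exists_vertEquiv (p : P) : ∃ e : GroupLieAlgebra IG G ≃L[ℝ] B.vertical p,
    ∀ ξ, (e ξ : TangentSpace IP p) = B.infAct p ξ := by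
  obtain ⟨t, ht⟩ := B.exists_localTriv (B.proj p)
  refine ⟨ContinuousLinearEquiv.equivOfInverse
    ((B.infAct p).codRestrict (B.vertical p) (B.infAct_mem_vertical p))
    ((t.flatForm p).comp (B.vertical p).subtypeL) (fun ξ => t.flatForm_infAct ht ξ)
    (fun X => Subtype.ext ?_), fun ξ => rfl⟩
  have h := t.decomp ht X
  have hX : mfderiv IP IM B.proj p X = 0 := X.2
  rw [hX, map_zero, zero_add] at h
  exact h

/-- The identification `𝔤 ≃ V_p P`, `ξ ↦ d/dt|₀ p · exp (t ξ)`. -/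
def vertEquiv (p : P) : GroupLieAlgebra IG G ≃L[ℝ] B.vertical p :=
  (B.exists_vertEquiv p).choose

theorem vertEquiv_apply (p : P) (ξ : GroupLieAlgebra IG G) :
    (B.vertEquiv p ξ : TangentSpace IP p) = B.infAct p ξ :=
  (B.exists_vertEquiv p).choose_spec ξ

end Vertical

section Jets

variable (B)

/-- The fibre over `p` of the first jet bundle: the right inverses of the derivative of the
projection. -/
def JetFiber (p : P) : Type _ :=
  {ρ : TangentSpace IM (B.proj p) →L[ℝ] TangentSpace IP p //
    ∀ v, mfderiv IP IM B.proj p (ρ v) = v}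

instance (p : P) : TopologicalSpace (B.JetFiber p) := instTopologicalSpaceSubtype

/-- The first jet bundle `J¹P`, as a set; `TotalSpace.proj` is the projection `τ₁₀`. -/
abbrev J1 : Type _ := TotalSpace (EM →L[ℝ] EG) B.JetFiber

/-- The projection `τ₁₀ : J¹P → P`. -/
abbrev tau10 (ρ : B.J1) : P := ρ.proj

variable [LieGroup IG ∞ G]

instance (p : P) : Nonempty (B.JetFiber p) := by
  obtain ⟨t, ht⟩ := B.exists_localTriv (B.proj p)
  exact ⟨⟨t.flatLift p, t.proj_flatLift ht⟩⟩

variable [IsManifold IM ∞ M] [IsManifold IP ∞ P]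
variable {B}

/-- The coordinate of a jet `ρ` at `p`, in a local trivialization of `P` and the chart of `M` at
`x₀`. -/
def jetCoord (t : B.LocalTriv) (x₀ : M) {p : P} (ρ : B.JetFiber p) : EM →L[ℝ] EG :=
  ((t.flatForm p).comp ρ.1).comp
    ((trivializationAt EM (TangentSpace IM) x₀).symmL ℝ (B.proj p))

/-- The domain of `jetCoord`. -/
def jetDom (t : B.LocalTriv) (x₀ : M) : Set P :=
  B.proj ⁻¹' (t.baseSet ∩ (trivializationAt EM (TangentSpace IM) x₀).baseSet)

/-- The jet at `p` with a given coordinate. -/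
def jetOfCoord (t : B.LocalTriv) (x₀ : M) {p : P} (hp : p ∈ jetDom t x₀)
    (A : EM →L[ℝ] EG) : B.JetFiber p :=
  ⟨t.flatLift p + (B.infAct p).comp (A.comp
    ((trivializationAt EM (TangentSpace IM) x₀).continuousLinearMapAt ℝ (B.proj p))), by
    intro v
    refine (map_add (mfderiv IP IM B.proj p) _ _).trans ?_
    exact (congrArg₂ (· + ·) (t.proj_flatLift hp.1 v) (B.proj_infAct p _)).trans (add_zero v)⟩

theorem jetOfCoord_jetCoord (t : B.LocalTriv) (x₀ : M) {p : P} (hp : p ∈ jetDom t x₀)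
    (ρ : B.JetFiber p) : jetOfCoord t x₀ hp (jetCoord t x₀ ρ) = ρ := by
  refine Subtype.ext (ContinuousLinearMap.ext fun v => ?_)
  have h := t.decomp hp.1 (ρ.1 v)
  rw [ρ.2 v] at h
  have h2 : (trivializationAt EM (TangentSpace IM) x₀).symmL ℝ (B.proj p)
    ((trivializationAt EM (TangentSpace IM) x₀).continuousLinearMapAt ℝ (B.proj p) v) = v :=
    Trivialization.symmL_continuousLinearMapAt _ hp.2 v
  refine Eq.trans ?_ h
  exact congrArg (fun w => t.flatLift p v + B.infAct p (t.flatForm p (ρ.1 w))) h2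

theorem jetCoord_jetOfCoord (t : B.LocalTriv) (x₀ : M) {p : P} (hp : p ∈ jetDom t x₀)
    (A : EM →L[ℝ] EG) : jetCoord t x₀ (jetOfCoord t x₀ hp A) = A := by
  refine ContinuousLinearMap.ext fun v => ?_
  have h2 : (trivializationAt EM (TangentSpace IM) x₀).continuousLinearMapAt ℝ (B.proj p)
    ((trivializationAt EM (TangentSpace IM) x₀).symmL ℝ (B.proj p) v) = v :=
    Trivialization.continuousLinearMapAt_symmL _ hp.2 v
  refine (map_add (t.flatForm p) _ _).trans ?_
  refine (congrArg₂ (· + ·) (t.flatForm_flatLift hp.1 _) (t.flatForm_infAct hp.1 _)).trans ?_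
  exact (zero_add _).trans (congrArg A h2)

theorem isOpen_jetDom (t : B.LocalTriv) (x₀ : M) : IsOpen (jetDom t x₀) :=
  (t.open_baseSet.inter (trivializationAt EM (TangentSpace IM) x₀).open_baseSet).preimage
    B.contMDiff_proj.continuous

open Classical in
/-- The local trivialization of `J¹P → P` given by `jetCoord`. -/
def jetPretriv (t : B.LocalTriv) (x₀ : M) :
    Pretrivialization (EM →L[ℝ] EG) (π (EM →L[ℝ] EG) B.JetFiber) where
  toFun ρ := (ρ.1, jetCoord t x₀ ρ.2)
  invFun z := if hz : z.1 ∈ jetDom t x₀ then ⟨z.1, jetOfCoord t x₀ hz z.2⟩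
    else ⟨z.1, Classical.arbitrary _⟩
  source := π (EM →L[ℝ] EG) B.JetFiber ⁻¹' jetDom t x₀
  target := jetDom t x₀ ×ˢ univ
  map_source' ρ hρ := ⟨hρ, mem_univ _⟩
  map_target' z hz := by
    simp only [dif_pos hz.1]; exact hz.1
  left_inv' := by
    rintro ⟨p, ρ⟩ (hρ : p ∈ jetDom t x₀)
    simp only [dif_pos hρ, jetOfCoord_jetCoord]
  right_inv' := by
    rintro ⟨p, A⟩ hz
    have hp : p ∈ jetDom t x₀ := hz.1
    dsimp only
    rw [dif_pos hp, jetCoord_jetOfCoord]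
  open_target := (isOpen_jetDom t x₀).prod isOpen_univ
  baseSet := jetDom t x₀
  open_baseSet := isOpen_jetDom t x₀
  source_eq := rfl
  target_eq := rfl
  proj_toFun _ _ := rfl

theorem coordChangeL_eq (x₀ x₀' : M) {x : M}
    (h : x ∈ (trivializationAt EM (TangentSpace IM) x₀).baseSet)
    (h' : x ∈ (trivializationAt EM (TangentSpace IM) x₀').baseSet) (v : EM) :
    (trivializationAt EM (TangentSpace IM) x₀).coordChangeL ℝ
          (trivializationAt EM (TangentSpace IM) x₀') x v =
      (trivializationAt EM (TangentSpace IM) x₀').continuousLinearMapAt ℝ x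
        ((trivializationAt EM (TangentSpace IM) x₀).symmL ℝ x v) := by
  rw [Trivialization.coordChangeL_apply _ _ ⟨h, h'⟩,
    Trivialization.continuousLinearMapAt_apply, Trivialization.coe_linearMapAt_of_mem _ h',
    Trivialization.symmL_apply _ h]

/-- The affine change of coordinates between two local trivializations of `J¹P → P`. -/
def jetShift (t t' : B.LocalTriv) (x₀ : M) (p : P) : EM →L[ℝ] EG :=
  ((t.flatForm p).comp (t'.flatLift p)).comp
    ((trivializationAt EM (TangentSpace IM) x₀).symmL ℝ (B.proj p))

theorem jetPretriv_change (t t' : B.LocalTriv) (x₀ x₀' : M) {z : P × (EM →L[ℝ] EG)}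
    (hz : z.1 ∈ jetDom t x₀) (hz' : z.1 ∈ jetDom t' x₀') :
    jetPretriv t x₀ ((jetPretriv t' x₀').toPartialEquiv.symm z) =
      (z.1, jetShift t t' x₀ z.1 + z.2.comp
        ((trivializationAt EM (TangentSpace IM) x₀).coordChangeL ℝ
          (trivializationAt EM (TangentSpace IM) x₀') (B.proj z.1) : EM →L[ℝ] EM)) := by
  have h1 : (jetPretriv t' x₀').toPartialEquiv.symm z = ⟨z.1, jetOfCoord t' x₀' hz' z.2⟩ :=
    dif_pos hz'
  rw [h1]
  refine Prod.ext rfl (ContinuousLinearMap.ext fun v => ?_)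
  refine (map_add (t.flatForm z.1) _ _).trans ?_
  refine congrArg₂ (· + ·) rfl ((t.flatForm_infAct hz.1 _).trans (congrArg z.2 ?_))
  exact (coordChangeL_eq x₀ x₀' hz.2 hz'.2 v).symm

theorem continuousLinearMapAt_self {g : G} (hg : g = 1) (v : TangentSpace IG g) :
    (trivializationAt EG (TangentSpace IG) (1 : G)).continuousLinearMapAt ℝ g v =
      tangentCongr IG hg v := by
  subst hg
  rw [TangentBundle.continuousLinearMapAt_trivializationAt_eq_core (mem_chart_source HG _)]
  exact (tangentBundleCore IG G).coordChange_self (achart HG 1) 1 (mem_chart_source HG _) v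

theorem contMDiffAt_jetShift (t t' : B.LocalTriv) (x₀ : M) {p : P}
    (hp : p ∈ jetDom t x₀) (hp' : B.proj p ∈ t'.baseSet) :
    ContMDiffAt IP 𝓘(ℝ, EM →L[ℝ] EG) ∞ (jetShift t t' x₀) p := by
  let f : P → M → G := fun q y => (t.fib q)⁻¹ * t.fib (t'.inv y (t'.fib q))
  have hinv : ContMDiffAt (IP.prod IM) IP ∞ (fun z : P × M => t'.inv z.2 (t'.fib z.1))
      (p, B.proj p) :=
    (t'.contMDiffAt_inv hp' (t'.fib p)).comp (p, B.proj p)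
      (f := fun z : P × M => (z.2, t'.fib z.1))
      (contMDiffAt_snd.prodMk (ContMDiffAt.comp (p, B.proj p) (g := t'.fib) (f := Prod.fst)
        (t'.contMDiffAt_fib hp') contMDiffAt_fst))
  have hf : ContMDiffAt (IP.prod IM) IG ∞ (Function.uncurry f) (p, B.proj p) := by
    refine ContMDiffAt.mul (ContMDiffAt.inv ?_) ?_
    · exact ContMDiffAt.comp (p, B.proj p) (g := t.fib) (f := Prod.fst)
        (t.contMDiffAt_fib hp.1) contMDiffAt_fst
    · refine ContMDiffAt.comp (p, B.proj p) (g := t.fib) ?_ hinv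
      rw [t'.inv_fib hp']
      exact t.contMDiffAt_fib hp.1
  have h1 := ContMDiffAt.mfderiv (m := ∞) f B.proj hf B.contMDiff_proj.contMDiffAt (by simp)
  have h2 : ContMDiffAt IP 𝓘(ℝ, EM →L[ℝ] EM) ∞ (fun q =>
      ((trivializationAt EM (TangentSpace IM) x₀).coordChangeL ℝ
        (trivializationAt EM (TangentSpace IM) (B.proj p)) (B.proj q) : EM →L[ℝ] EM)) p :=
    ContMDiffAt.coordChangeL B.contMDiff_proj.contMDiffAt hp.2
      (mem_baseSet_trivializationAt EM (TangentSpace IM) (B.proj p))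
  refine (h1.clm_comp h2).congr_of_eventuallyEq ?_
  have hone : ∀ q, B.proj q ∈ t'.baseSet → f q (B.proj q) = 1 := by
    intro q hq; simp [f, t'.inv_fib hq]
  filter_upwards [(isOpen_jetDom t x₀).mem_nhds hp, t'.nhds_base hp',
    B.contMDiff_proj.continuous.continuousAt
      ((trivializationAt EM (TangentSpace IM) (B.proj p)).open_baseSet.mem_nhds
        (mem_baseSet_trivializationAt EM (TangentSpace IM) (B.proj p)))] with q hq hq' hqp
  refine ContinuousLinearMap.ext fun v => ?_
  set w : TangentSpace IM (B.proj q) :=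
    (trivializationAt EM (TangentSpace IM) x₀).symmL ℝ (B.proj q) v with hw
  have e1 : t.flatForm q (t'.flatLift q w) =
      tangentCongr IG (hone q hq') (mfderiv IM IG (f q) (B.proj q) w) := by
    rw [t'.flatLift_apply hq', t.flatForm_apply]
    exact mfderiv_chain ((t'.contMDiffAt_inv_left hq' _).mdifferentiableAt (by simp))
      ((t.contMDiffAt_flat hq.1 (t.fib q)).mdifferentiableAt (by simp)) (t'.inv_fib hq')
      (inv_mul_cancel _) (hone q hq') (by rfl) w
  have e2 : (trivializationAt EM (TangentSpace IM) (B.proj p)).symmL ℝ (B.proj q)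
      ((trivializationAt EM (TangentSpace IM) x₀).coordChangeL ℝ
        (trivializationAt EM (TangentSpace IM) (B.proj p)) (B.proj q) v) = w := by
    rw [coordChangeL_eq x₀ (B.proj p) hq.2 hqp]
    exact Trivialization.symmL_continuousLinearMapAt _ hqp w
  have e3 : (trivializationAt EG (TangentSpace IG) (f p (B.proj p))).continuousLinearMapAt ℝ
      (f q (B.proj q)) (mfderiv IM IG (f q) (B.proj q) w) = t.flatForm q (t'.flatLift q w) := by
    rw [e1, hone p hp']
    exact continuousLinearMapAt_self (hone q hq') _
  refine Eq.trans (Eq.symm e3) ?_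
  exact congrArg (fun u => (trivializationAt EG (TangentSpace IG)
    (f p (B.proj p))).continuousLinearMapAt ℝ
      (f q (B.proj q)) (mfderiv IM IG (f q) (B.proj q) u)) e2.symm

theorem contMDiffOn_jetPretriv_change (t t' : B.LocalTriv) (x₀ x₀' : M) :
    ContMDiffOn (IP.prod 𝓘(ℝ, EM →L[ℝ] EG)) (IP.prod 𝓘(ℝ, EM →L[ℝ] EG)) ∞
      (jetPretriv t x₀ ∘ (jetPretriv t' x₀').toPartialEquiv.symm)
      ((jetDom t' x₀' ∩ jetDom t x₀) ×ˢ univ) := by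
  have h : ContMDiffOn (IP.prod 𝓘(ℝ, EM →L[ℝ] EG)) (IP.prod 𝓘(ℝ, EM →L[ℝ] EG)) ∞
      (fun z : P × (EM →L[ℝ] EG) => (z.1, jetShift t t' x₀ z.1 + z.2.comp
        ((trivializationAt EM (TangentSpace IM) x₀).coordChangeL ℝ
          (trivializationAt EM (TangentSpace IM) x₀') (B.proj z.1) : EM →L[ℝ] EM)))
      ((jetDom t' x₀' ∩ jetDom t x₀) ×ˢ univ) := by
    rintro ⟨p, A⟩ ⟨⟨hp', hp⟩, -⟩
    refine ContMDiffAt.contMDiffWithinAt ?_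
    refine contMDiffAt_fst.prodMk (ContMDiffAt.add ?_ (ContMDiffAt.clm_comp contMDiffAt_snd ?_))
    · exact ContMDiffAt.comp (p, A) (g := jetShift t t' x₀) (f := Prod.fst)
        (contMDiffAt_jetShift t t' x₀ hp hp'.1) contMDiffAt_fst
    · exact ContMDiffAt.coordChangeL (f := fun z : P × (EM →L[ℝ] EG) => B.proj z.1)
        (B.contMDiff_proj.contMDiffAt.comp (p, A) contMDiffAt_fst) hp.2 hp'.2
  exact h.congr fun z hz => jetPretriv_change t t' x₀ x₀' hz.1.2 hz.1.1

theorem jetPretriv_change_dom (t t' : B.LocalTriv) (x₀ x₀' : M) :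
    (jetPretriv t' x₀').target ∩
      (jetPretriv t' x₀').toPartialEquiv.symm ⁻¹' (jetPretriv t x₀).source =
      (jetDom t' x₀' ∩ jetDom t x₀) ×ˢ univ := by
  ext ⟨p, A⟩
  constructor
  · rintro ⟨h1, h2⟩
    have hp : p ∈ jetDom t' x₀' := h1.1
    refine ⟨⟨hp, ?_⟩, mem_univ _⟩
    have h3 : (jetPretriv t' x₀').toPartialEquiv.symm (p, A) = ⟨p, jetOfCoord t' x₀' hp A⟩ :=
      dif_pos hp
    rw [mem_preimage, h3] at h2
    exact h2
  · rintro ⟨⟨hp, hp'⟩, -⟩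
    refine ⟨⟨hp, mem_univ _⟩, ?_⟩
    have h3 : (jetPretriv t' x₀').toPartialEquiv.symm (p, A) = ⟨p, jetOfCoord t' x₀' hp A⟩ :=
      dif_pos hp
    rw [mem_preimage, h3]
    exact hp'

theorem isInducing_jetPretriv (t : B.LocalTriv) (x₀ : M) {p : P} (hp : p ∈ jetDom t x₀) :
    Topology.IsInducing (jetPretriv t x₀ ∘ TotalSpace.mk p) := by
  let e := trivializationAt EM (TangentSpace IM) x₀
  have h1 : Continuous (fun ρ : B.JetFiber p => jetCoord t x₀ ρ) := by
    have c1 := (ContinuousLinearMap.postcomp (𝕜₁ := ℝ) (σ := RingHom.id ℝ)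
      (TangentSpace IM (B.proj p)) (t.flatForm p)).continuous
    have c2 := (ContinuousLinearMap.precomp (𝕜₂ := ℝ) (τ := RingHom.id ℝ)
      (GroupLieAlgebra IG G) (e.symmL ℝ (B.proj p))).continuous
    exact c2.comp (c1.comp continuous_subtype_val)
  refine Topology.IsInducing.of_comp (g := fun z : P × (EM →L[ℝ] EG) =>
    t.flatLift p + (B.infAct p).comp (z.2.comp (e.continuousLinearMapAt ℝ (B.proj p))))
     (continuous_const.prodMk h1) ?_ ?_
  · have c1 := (ContinuousLinearMap.postcomp (𝕜₁ := ℝ) (σ := RingHom.id ℝ)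
      (TangentSpace IM (B.proj p)) (B.infAct p)).continuous
    have c2 := (ContinuousLinearMap.precomp (𝕜₂ := ℝ) (τ := RingHom.id ℝ)
      EG (e.continuousLinearMapAt ℝ (B.proj p))).continuous
    exact continuous_const.add (c1.comp (c2.comp continuous_snd))
  · have : ((fun z : P × (EM →L[ℝ] EG) => t.flatLift p +
        (B.infAct p).comp (z.2.comp (e.continuousLinearMapAt ℝ (B.proj p)))) ∘
        (jetPretriv t x₀ ∘ TotalSpace.mk p)) = Subtype.val := by
      funext ρ
      exact congrArg Subtype.val (jetOfCoord_jetCoord t x₀ hp ρ)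
    rw [this]
    exact Topology.IsInducing.subtypeVal

variable (B)

/-- A local trivialization around a given point. -/
def trivAt (x : M) : B.LocalTriv := (B.exists_localTriv x).choose

theorem mem_trivAt (x : M) : x ∈ (B.trivAt x).baseSet := (B.exists_localTriv x).choose_spec

theorem mem_jetDom (p : P) : p ∈ jetDom (B.trivAt (B.proj p)) (B.proj p) :=
  ⟨B.mem_trivAt _, mem_baseSet_trivializationAt EM (TangentSpace IM) (B.proj p)⟩

/-- The bundle structure of `J¹P → P`. Its trivializations `jetPretriv` give `J¹P` its topology and
its smooth structure, the standard one: the charts are the fibred coordinates of a local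
trivialization of `P` and a chart of `M`. -/
def jetPrebundle : FiberPrebundle (EM →L[ℝ] EG) B.JetFiber where
  pretrivializationAtlas := range fun i : B.LocalTriv × M => jetPretriv i.1 i.2
  pretrivializationAt p := jetPretriv (B.trivAt (B.proj p)) (B.proj p)
  mem_base_pretrivializationAt p := B.mem_jetDom p
  pretrivialization_mem_atlas p := ⟨(B.trivAt (B.proj p), B.proj p), rfl⟩
  continuous_trivChange := by
    rintro _ ⟨⟨t, x₀⟩, rfl⟩ _ ⟨⟨t', x₀'⟩, rfl⟩
    rw [jetPretriv_change_dom]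
    exact (contMDiffOn_jetPretriv_change t t' x₀ x₀').continuousOn
  totalSpaceMk_isInducing p := isInducing_jetPretriv _ _ (B.mem_jetDom p)

instance : TopologicalSpace B.J1 := B.jetPrebundle.totalSpaceTopology

instance : FiberBundle (EM →L[ℝ] EG) B.JetFiber := B.jetPrebundle.toFiberBundle

/-- The groupoid of the local diffeomorphisms of a manifold. -/
def smoothGroupoid {E H : Type*} [NormedAddCommGroup E] [NormedSpace ℝ E] [TopologicalSpace H]
    (I : ModelWithCorners ℝ E H) (X : Type*) [TopologicalSpace X] [ChartedSpace H X] :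
    StructureGroupoid X :=
  Pregroupoid.groupoid
    { property := fun f s => ContMDiffOn I I ∞ f s
      comp := fun {f g u v} hf hg _ _ _ =>
        hg.comp (hf.mono inter_subset_left) (fun x hx => hx.2)
      id_mem := contMDiffOn_id
      locality := fun {f u} _ h x hx => by
        obtain ⟨v, hv, hxv, h⟩ := h x hx
        exact (h x ⟨hx, hxv⟩).mono_of_mem_nhdsWithin
          (inter_mem_nhdsWithin _ (hv.mem_nhds hxv))
      congr := fun {f g u} _ h hf => hf.congr h }

/-- `J¹P` is a smooth manifold. -/
instance : IsManifold (IP.prod 𝓘(ℝ, EM →L[ℝ] EG)) ∞ B.J1 := by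
  have key : ∀ e ∈ trivializationAtlas (EM →L[ℝ] EG) B.JetFiber,
      ∀ e' ∈ trivializationAtlas (EM →L[ℝ] EG) B.JetFiber,
      ContMDiffOn (IP.prod 𝓘(ℝ, EM →L[ℝ] EG)) (IP.prod 𝓘(ℝ, EM →L[ℝ] EG)) ∞
        (e.toOpenPartialHomeomorph.symm ≫ₕ e'.toOpenPartialHomeomorph)
        (e.toOpenPartialHomeomorph.symm ≫ₕ e'.toOpenPartialHomeomorph).source := by
    rintro _ ⟨_, ⟨⟨t, x₀⟩, rfl⟩, rfl⟩ _ ⟨_, ⟨⟨t', x₀'⟩, rfl⟩, rfl⟩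
    refine (contMDiffOn_jetPretriv_change t' t x₀' x₀).mono ?_
    rw [← jetPretriv_change_dom]
    exact subset_rfl
  have : HasGroupoid B.J1 (smoothGroupoid (IP.prod 𝓘(ℝ, EM →L[ℝ] EG)) (P × (EM →L[ℝ] EG))) := by
    constructor
    rintro _ _ ⟨e, he, rfl⟩ ⟨e', he', rfl⟩
    refine mem_groupoid_of_pregroupoid.2 ⟨key e he e' he', ?_⟩
    exact key e' he' e he
  refine { StructureGroupoid.HasGroupoid.comp
    (smoothGroupoid (IP.prod 𝓘(ℝ, EM →L[ℝ] EG)) (P × (EM →L[ℝ] EG))) ?_ with }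
  intro e he
  rw [isLocalStructomorphOn_contDiffGroupoid_iff]
  exact mem_groupoid_of_pregroupoid.1 he

end Jets

section ConnectionBundle

variable (B)

/-- The right action of `G` on `J¹P` lifted from `P`: `ρ · g = T_p R_g ∘ ρ`. -/
def jetAct (ρ : B.J1) (g : G) : B.J1 :=
  ⟨B.act ρ.proj g,
    ⟨((mfderiv IP IP (fun q => B.act q g) ρ.proj).comp ρ.snd.1).comp
      (tangentCongr IM (B.proj_act ρ.proj g)).toContinuousLinearMap, by
    intro v
    have h := mfderiv_chain (k := B.proj) (z := B.proj ρ.proj)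
      (B.mdifferentiable_act_right g ρ.proj) (B.mdifferentiable_proj _) rfl
      (B.proj_act ρ.proj g) rfl (by filter_upwards with q using B.proj_act q g)
      (ρ.snd.1 (tangentCongr IM (B.proj_act ρ.proj g) v))
    rw [ρ.snd.2] at h
    exact (tangentCongr IM (B.proj_act ρ.proj g)).injective h⟩⟩

theorem jet_ext {ρ ρ' : B.J1} (h : ρ.proj = ρ'.proj)
    (h' : ∀ v, tangentCongr IP h (ρ.snd.1 v) =
      ρ'.snd.1 (tangentCongr IM (congrArg B.proj h) v)) : ρ = ρ' := by
  obtain ⟨p, ρ⟩ := ρ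
  obtain ⟨p', ρ'⟩ := ρ'
  obtain rfl : p = p' := h
  exact congrArg (TotalSpace.mk p) (Subtype.ext (ContinuousLinearMap.ext h'))

theorem jetAct_one (ρ : B.J1) : B.jetAct ρ 1 = ρ := by
  refine B.jet_ext (B.act_one _) fun v => ?_
  have h := tangentCongr_mfderiv (I := IP) (J := IP) (x := ρ.proj) (y := ρ.proj)
    (f := fun q => B.act q 1) (g := id) (funext B.act_one) (B.act_one _) rfl
    (ρ.snd.1 (tangentCongr IM (B.proj_act ρ.proj 1) v))
  rw [mfderiv_id] at h
  exact h

theorem jetAct_mul (ρ : B.J1) (g h : G) : B.jetAct ρ (g * h) = B.jetAct (B.jetAct ρ g) h := by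
  refine B.jet_ext (B.act_mul _ _ _) fun v => ?_
  have e := mfderiv_chain (I := IP) (J := IP) (K := IP) (x := ρ.proj)
    (k := fun q => B.act q (g * h)) (B.mdifferentiable_act_right g ρ.proj)
    (B.mdifferentiable_act_right h _) rfl rfl (B.act_mul _ _ _)
    (by filter_upwards with q using (B.act_mul q g h).symm)
    (ρ.snd.1 (tangentCongr IM (B.proj_act ρ.proj (g * h)) v))
  refine e.symm.trans ?_
  have e2 : tangentCongr IM (B.proj_act ρ.proj (g * h)) v =
      tangentCongr IM (B.proj_act ρ.proj g) (tangentCongr IM (B.proj_act (B.act ρ.proj g) h)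
        (tangentCongr IM (congrArg B.proj (B.act_mul ρ.proj g h)) v)) := by
    refine ((tangentCongr_trans IM _ _ _).trans ?_).symm
    exact tangentCongr_trans IM _ _ _
  exact congrArg (fun w => mfderiv IP IP (fun q => B.act q h) (B.act ρ.proj g)
    (mfderiv IP IP (fun q => B.act q g) ρ.proj (ρ.snd.1 w))) e2

/-- The orbit equivalence relation of `G` on `J¹P`. -/
def jetSetoid : Setoid B.J1 where
  r ρ ρ' := ∃ g, B.jetAct ρ g = ρ'
  iseqv :=
    { refl := fun ρ => ⟨1, B.jetAct_one ρ⟩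
      symm := by
        rintro ρ _ ⟨g, rfl⟩
        exact ⟨g⁻¹, by rw [← B.jetAct_mul, mul_inv_cancel, B.jetAct_one]⟩
      trans := by
        rintro ρ _ _ ⟨g, rfl⟩ ⟨h, rfl⟩
        exact ⟨g * h, B.jetAct_mul ρ g h⟩ }

/-- The bundle of connections `C(P) = J¹P / G`. -/
def ConnBundle : Type _ := Quotient B.jetSetoid

/-- The class `[ρ]_G`. -/
def toConn (ρ : B.J1) : B.ConnBundle := Quotient.mk B.jetSetoid ρ

/-- The projection `p : C(P) → M`. -/
def connProj : B.ConnBundle → M :=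
  Quotient.lift (fun ρ : B.J1 => B.proj ρ.proj) (by
    rintro ρ _ ⟨g, rfl⟩
    exact (B.proj_act ρ.proj g).symm)

/-- The pullback bundle `p^*P ⊆ C(P) × P`. -/
def ConnPullback : Type _ := {x : B.ConnBundle × P // B.connProj x.1 = B.proj x.2}

/-- The map `J¹P → p^*P`, `ρ ↦ ([ρ]_G, τ₁₀ ρ)`. -/
def toConnPullback (ρ : B.J1) : B.ConnPullback := ⟨(B.toConn ρ, B.tau10 ρ), rfl⟩

theorem toConnPullback_bijective : Function.Bijective B.toConnPullback := by
  constructor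
  · intro ρ ρ' h
    have h1 : B.toConn ρ = B.toConn ρ' := congrArg (fun x => x.1.1) h
    have h2 : ρ.proj = ρ'.proj := congrArg (fun x => x.1.2) h
    obtain ⟨g, rfl⟩ := Quotient.exact h1
    have hg : g = 1 := B.act_free ρ.proj g h2.symm
    rw [hg, B.jetAct_one]
  · rintro ⟨⟨c, u⟩, h⟩
    obtain ⟨ρ, rfl⟩ := Quotient.exists_rep c
    obtain ⟨g, hg⟩ := (B.proj_eq_iff ρ.proj u).1 h
    refine ⟨B.jetAct ρ g, Subtype.ext (Prod.ext ?_ hg)⟩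
    exact (Quotient.sound (s := B.jetSetoid) ⟨g, rfl⟩).symm

/-- The identification `J¹P ≃ p^*P`. -/
def jetEquivPullback : B.J1 ≃ B.ConnPullback :=
  Equiv.ofBijective B.toConnPullback B.toConnPullback_bijective

variable {B}

/-- The projection `id - ρ ∘ T τ : T_p P → V_p P` determined by a jet `ρ` at `p`. -/
def jetProj (ρ : B.J1) : TangentSpace IP ρ.proj →L[ℝ] TangentSpace IP ρ.proj :=
  ContinuousLinearMap.id ℝ _ - ρ.snd.1.comp (mfderiv IP IM B.proj ρ.proj)

theorem jetProj_mem (ρ : B.J1) (X : TangentSpace IP ρ.proj) :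
    jetProj ρ X ∈ B.vertical ρ.proj := by
  change mfderiv IP IM B.proj ρ.proj (X - ρ.snd.1 (mfderiv IP IM B.proj ρ.proj X)) = 0
  rw [map_sub, ρ.snd.2, sub_self]

end ConnectionBundle

section Connections

variable (B)

/-- A principal connection: a smooth `G`-equivariant family of projections
`Γ_p : T_p P → V_p P` onto the vertical subspaces. -/
structure Connection [IsManifold IP ∞ P] where
  toFun : ∀ p : P, TangentSpace IP p →L[ℝ] TangentSpace IP p
  mem_vertical : ∀ p X, toFun p X ∈ B.vertical p
  apply_vertical : ∀ p, ∀ X ∈ B.vertical p, toFun p X = X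
  equivariant : ∀ p g X, toFun (B.act p g) (mfderiv IP IP (fun q => B.act q g) p X) =
    mfderiv IP IP (fun q => B.act q g) p (toFun p X)
  contMDiff_toFun : ContMDiff IP (IP.prod 𝓘(ℝ, EP →L[ℝ] EP)) ∞
    (fun p => TotalSpace.mk' (EP →L[ℝ] EP)
      (E := fun p : P => TangentSpace IP p →L[ℝ] TangentSpace IP p) p (toFun p))

variable {B} [LieGroup IG ∞ G] [IsManifold IP ∞ P]

namespace Connection

variable (Γ : B.Connection)

/-- The connection form `ω_Γ ∈ Ω¹(P, 𝔤)`. -/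
def form (p : P) : TangentSpace IP p →L[ℝ] GroupLieAlgebra IG G :=
  (B.vertEquiv p).symm.toContinuousLinearMap.comp
    ((Γ.toFun p).codRestrict (B.vertical p) (Γ.mem_vertical p))

theorem exists_jet (p : P) : ∃ ρ : B.JetFiber p, jetProj (B := B) ⟨p, ρ⟩ = Γ.toFun p := by
  obtain ⟨t, ht⟩ := B.exists_localTriv (B.proj p)
  have hΓ : ∀ X, mfderiv IP IM B.proj p (Γ.toFun p X) = 0 := Γ.mem_vertical p
  refine ⟨⟨t.flatLift p - (Γ.toFun p).comp (t.flatLift p), fun v => ?_⟩,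
    ContinuousLinearMap.ext fun (X : TangentSpace IP p) => ?_⟩
  · change mfderiv IP IM B.proj p (t.flatLift p v - Γ.toFun p (t.flatLift p v)) = v
    rw [map_sub, t.proj_flatLift ht, hΓ, sub_zero]
  · have h1 : Γ.toFun p (X - t.flatLift p (mfderiv IP IM B.proj p X)) =
        X - t.flatLift p (mfderiv IP IM B.proj p X) := by
      refine Γ.apply_vertical p _ ?_
      change mfderiv IP IM B.proj p (X - t.flatLift p (mfderiv IP IM B.proj p X)) = 0
      rw [map_sub, t.proj_flatLift ht, sub_self]
    rw [map_sub] at h1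
    change X - (t.flatLift p (mfderiv IP IM B.proj p X) -
      Γ.toFun p (t.flatLift p (mfderiv IP IM B.proj p X))) = Γ.toFun p X
    rw [sub_eq_iff_eq_add] at h1
    rw [h1]
    abel

/-- The section `σ_Γ : M → C(P)`: `σ_Γ(m) = [ρ]_G` for a jet `ρ` over `m` whose vertical
projection is the one of `Γ`. -/
def sigma (m : M) : B.ConnBundle :=
  let p : P := (B.proj_surjective m).choose
  B.toConn ⟨p, (Γ.exists_jet p).choose⟩

theorem connProj_sigma (m : M) : B.connProj (Γ.sigma m) = m := (B.proj_surjective m).choose_spec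

/-- The section `σ̃_Γ : P → J¹P`, `u ↦ (σ_Γ(τ u), u)` under the identification `J¹P ≃ p^*P`. -/
def sigmaTilde (u : P) : B.J1 :=
  B.jetEquivPullback.symm ⟨(Γ.sigma (B.proj u), u), Γ.connProj_sigma (B.proj u)⟩

end Connection

variable [IsManifold IM ∞ M]
variable (B) in
/-- The canonical form `ω ∈ Ω¹(J¹P, 𝔤)`: `ω_ρ(Y)` is the element of `𝔤` that corresponds to the
vertical vector `(id - ρ ∘ T τ)(T τ₁₀ Y)`. -/
def canonicalForm (ρ : B.J1) :
    TangentSpace (IP.prod 𝓘(ℝ, EM →L[ℝ] EG)) ρ →L[ℝ] GroupLieAlgebra IG G :=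
  ((B.vertEquiv ρ.proj).symm.toContinuousLinearMap.comp
    ((jetProj ρ).codRestrict (B.vertical ρ.proj) (jetProj_mem ρ))).comp
      (mfderiv (IP.prod 𝓘(ℝ, EM →L[ℝ] EG)) IP B.tau10 ρ)

end Connections

end PrincipalBundle

/-- The pullback of a `V`-valued 1-form. -/
def pullbackForm {E H X E' H' Y V : Type*} [NormedAddCommGroup E] [NormedSpace ℝ E]
    [TopologicalSpace H] (I : ModelWithCorners ℝ E H) [TopologicalSpace X] [ChartedSpace H X]
    [NormedAddCommGroup E'] [NormedSpace ℝ E'] [TopologicalSpace H']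
    (J : ModelWithCorners ℝ E' H') [TopologicalSpace Y] [ChartedSpace H' Y]
    [AddCommGroup V] [Module ℝ V] [TopologicalSpace V]
    (f : X → Y) (α : ∀ y : Y, TangentSpace J y →L[ℝ] V) (x : X) : TangentSpace I x →L[ℝ] V :=
  (α (f x)).comp (mfderiv I J f x)

end

/-! A jet `ρ` at `p` is determined by its vertical projection `id - ρ ∘ Tτ`: evaluated at `ρ v`,
this projection determines every other jet with the same projection. So `Γ` singles out exactly one
jet `Γ.jet p` at each point, its horizontal lift. Equivariance of `Γ` and uniqueness give `Γ.jet p ·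
g = Γ.jet (p · g)` (`jetAct_jet`), hence the class of `Γ.jet u` depends only on `τ u`, and
`sigmaTilde` is the map `u ↦ Γ.jet u` (`sigmaTilde_eq`).

With this formula the section property is immediate. For the pullback, `τ₁₀ ∘ σ̃ = id` makes `Tτ₁₀ ∘
Tσ̃` the identity, and what remains of `ω` at `Γ.jet u` is the vertical projection of that jet,
namely `Γ_u`.

Smoothness is checked in the fibred coordinates of `J¹P`. The coordinate of `Γ.jet` is minus the
composite flat form ∘ `Γ` ∘ flat lift (`jetCoord_jet`); the two flat factors are smooth as
derivatives of smooth families of maps, and `Γ` is smooth by assumption. -/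

namespace PrincipalBundle

variable {EM HM EP HP EG HG : Type*}
  [NormedAddCommGroup EM] [NormedSpace ℝ EM] [TopologicalSpace HM]
  [NormedAddCommGroup EP] [NormedSpace ℝ EP] [TopologicalSpace HP]
  [NormedAddCommGroup EG] [NormedSpace ℝ EG] [TopologicalSpace HG]
  {IM : ModelWithCorners ℝ EM HM} {IP : ModelWithCorners ℝ EP HP}
  {IG : ModelWithCorners ℝ EG HG}
  {M P G : Type*} [TopologicalSpace M] [ChartedSpace HM M]
  [TopologicalSpace P] [ChartedSpace HP P]
  [TopologicalSpace G] [ChartedSpace HG G] [Group G]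
  {B : PrincipalBundle IM IP IG M P G}

/-! ### Smoothness of the flat form and the flat lift of a trivialization -/

section Smoothness

variable [LieGroup IG ∞ G] [IsManifold IP ∞ P]

/-- The flat form of a local trivialization is smooth, read in the tangent trivialization of `P`
at a point. -/
theorem LocalTriv.contMDiffAt_flatForm (t : B.LocalTriv) {p : P} (hp : B.proj p ∈ t.baseSet) :
    ContMDiffAt (M' := EP →L[ℝ] EG) IP 𝓘(ℝ, EP →L[ℝ] EG) ∞
      (fun q => (t.flatForm q).comp
        ((trivializationAt EP (TangentSpace IP) p).symmL ℝ q)) p := by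
  -- The flat form at `q` is the derivative of `f q` at the point `q`: the first slot is a
  -- parameter, the second is differentiated. Smoothness of derivatives of parametrized maps then
  -- applies, with the identity as moving base point.
  let f : P → P → G := fun q y => (t.fib q)⁻¹ * t.fib y
  have hf : ContMDiffAt (IP.prod IP) IG ∞ (Function.uncurry f) (p, p) := by
    refine ContMDiffAt.mul (ContMDiffAt.inv ?_) ?_
    · exact ContMDiffAt.comp (p, p) (g := t.fib) (f := Prod.fst)
        (t.contMDiffAt_fib hp) contMDiffAt_fst
    · exact ContMDiffAt.comp (p, p) (g := t.fib) (f := Prod.snd)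
        (t.contMDiffAt_fib hp) contMDiffAt_snd
  have h := ContMDiffAt.mfderiv (m := ∞) f id hf contMDiffAt_id (by simp)
  refine h.congr_of_eventuallyEq (Eventually.of_forall fun q => ?_)
  refine ContinuousLinearMap.ext fun v => ?_
  -- On the diagonal `f` takes the value `1`, and the tangent trivialization of `G` at `1` is the
  -- identity on the Lie algebra; so the coordinates on the target side change nothing.
  have hone : ∀ q, f q q = 1 := fun q => inv_mul_cancel _
  set w : TangentSpace IP q := (trivializationAt EP (TangentSpace IP) p).symmL ℝ q v
  have e : (trivializationAt EG (TangentSpace IG) (f p p)).continuousLinearMapAt ℝ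
      (f q q) (mfderiv IP IG (f q) q w) = t.flatForm q w := by
    rw [hone p]
    exact continuousLinearMapAt_self (hone q) _
  exact e.symm

/-- Removes the transport along `t.inv_fib` that is built into `flatLift`. -/
theorem continuousLinearMapAt_tangentCongr (p : P) {x y : P} (h : x = y)
    (v : TangentSpace IP x) :
    (trivializationAt EP (TangentSpace IP) p).continuousLinearMapAt ℝ y (tangentCongr IP h v) =
      (trivializationAt EP (TangentSpace IP) p).continuousLinearMapAt ℝ x v := by
  subst h; rfl

variable [IsManifold IM ∞ M]

/-- The flat lift of a local trivialization is smooth, read in the tangent trivializations. -/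
theorem LocalTriv.contMDiffAt_flatLift (t : B.LocalTriv) {p : P} (hp : B.proj p ∈ t.baseSet) :
    ContMDiffAt IP 𝓘(ℝ, EM →L[ℝ] EP) ∞
      (fun q => ContinuousLinearMap.inCoordinates EM (TangentSpace IM) EP (TangentSpace IP)
        (B.proj p) (B.proj q) p q (t.flatLift q)) p := by
  -- Here `f q` is the local section through `q` that is constant in the trivialization; its
  -- derivative at `τ q` is the flat lift.
  let f : P → M → P := fun q y => t.inv y (t.fib q)
  have hf : ContMDiffAt (IP.prod IM) IP ∞ (Function.uncurry f) (p, B.proj p) :=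
    (t.contMDiffAt_inv hp (t.fib p)).comp (p, B.proj p)
      (f := fun z : P × M => (z.2, t.fib z.1))
      (contMDiffAt_snd.prodMk (ContMDiffAt.comp (p, B.proj p) (g := t.fib) (f := Prod.fst)
        (t.contMDiffAt_fib hp) contMDiffAt_fst))
  have h := ContMDiffAt.mfderiv (m := ∞) f B.proj hf B.contMDiff_proj.contMDiffAt (by simp)
  refine h.congr_of_eventuallyEq ?_
  -- Only nearby points count: off the base set `flatLift` has the default value `0`.
  filter_upwards [t.nhds_base hp] with q hq
  refine ContinuousLinearMap.ext fun v => ?_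
  set w : TangentSpace IM (B.proj q) :=
    (trivializationAt EM (TangentSpace IM) (B.proj p)).symmL ℝ (B.proj q) v
  have e : (trivializationAt EP (TangentSpace IP) (f p (B.proj p))).continuousLinearMapAt ℝ
      (f q (B.proj q)) (mfderiv IM IP (f q) (B.proj q) w) =
      (trivializationAt EP (TangentSpace IP) p).continuousLinearMapAt ℝ q (t.flatLift q w) := by
    rw [t.flatLift_apply hq, show f p (B.proj p) = p from t.inv_fib hp]
    exact (continuousLinearMapAt_tangentCongr p (t.inv_fib hq) _).symm
  exact e.symm

end Smoothness

/-! ### Vertical projections of jets and right translations -/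

/-- A jet is determined by its vertical projection. -/
theorem jetFiber_ext_jetProj {p : P} {ρ ρ' : B.JetFiber p}
    (h : jetProj (B := B) ⟨p, ρ⟩ = jetProj (B := B) ⟨p, ρ'⟩) : ρ = ρ' := by
  refine Subtype.ext (ContinuousLinearMap.ext fun v => ?_)
  -- At the vector `ρ v` both jets are applied to `Tτ (ρ v) = v`, which leaves `ρ v - ρ v = ρ v - ρ'
  -- v`.
  have h1 : ρ.1 v - ρ.1 (mfderiv IP IM B.proj p (ρ.1 v)) =
      ρ.1 v - ρ'.1 (mfderiv IP IM B.proj p (ρ.1 v)) := DFunLike.congr_fun h (ρ.1 v)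
  rw [ρ.2] at h1
  exact sub_right_injective h1

/-- The right translations have surjective derivatives. -/
theorem mfderiv_act_surjective (B : PrincipalBundle IM IP IG M P G) (p : P) (g : G) :
    Function.Surjective (mfderiv IP IP (fun q => B.act q g) p) := by
  intro X
  have hback : B.act (B.act p g) g⁻¹ = p := by rw [← B.act_mul, mul_inv_cancel, B.act_one]
  refine ⟨tangentCongr IP hback (mfderiv IP IP (fun q => B.act q g⁻¹) (B.act p g) X), ?_⟩
  have h := mfderiv_chain (I := IP) (J := IP) (K := IP) (k := id) (z := B.act p g)
    (B.mdifferentiable_act_right g⁻¹ (B.act p g)) (B.mdifferentiable_act_right g p) hback rfl rfl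
    (by filter_upwards with q; simp [← B.act_mul, B.act_one]) X
  rw [mfderiv_id] at h
  exact h

/-- Differentiates `τ ∘ R_g = τ`. The transport is the same one that occurs in `jetAct`, so the two
match in `jetProj_jetAct`. -/
theorem proj_mfderiv_act (B : PrincipalBundle IM IP IG M P G) (p : P) (g : G)
    (X : TangentSpace IP p) :
    tangentCongr IM (B.proj_act p g) (mfderiv IP IM B.proj (B.act p g)
      (mfderiv IP IP (fun q => B.act q g) p X)) = mfderiv IP IM B.proj p X :=
  mfderiv_chain (k := B.proj) (z := B.proj p) (B.mdifferentiable_act_right g p)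
    (B.mdifferentiable_proj _) rfl (B.proj_act p g) rfl
    (by filter_upwards with q using B.proj_act q g) X

/-- The vertical projection of a jet is equivariant. -/
theorem jetProj_jetAct (ρ : B.J1) (g : G) (X : TangentSpace IP ρ.proj) :
    jetProj (B.jetAct ρ g) (mfderiv IP IP (fun q => B.act q g) ρ.proj X) =
      mfderiv IP IP (fun q => B.act q g) ρ.proj (jetProj ρ X) := by
  have h := B.proj_mfderiv_act ρ.proj g X
  refine Eq.trans ?_ (map_sub (mfderiv IP IP (fun q => B.act q g) ρ.proj) X
    (ρ.snd.1 (mfderiv IP IM B.proj ρ.proj X))).symm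
  exact congrArg (fun w => mfderiv IP IP (fun q => B.act q g) ρ.proj X -
    mfderiv IP IP (fun q => B.act q g) ρ.proj (ρ.snd.1 w)) h

/-! ### The jet field of a connection and the formula for `sigmaTilde` -/

namespace Connection

variable [LieGroup IG ∞ G] [IsManifold IP ∞ P] (Γ : B.Connection)

/-- The horizontal lift of a connection, as a jet at `p`. -/
noncomputable def jet (p : P) : B.JetFiber p := (Γ.exists_jet p).choose

theorem jetProj_jet (p : P) : jetProj (B := B) ⟨p, Γ.jet p⟩ = Γ.toFun p :=
  (Γ.exists_jet p).choose_spec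

/-- Both sides are jets at `p · g`, so comparing vertical projections suffices. As `T R_g` is onto,
these need only be compared on vectors `T R_g X`, where the equality is the equivariance of `Γ`. -/
theorem jetAct_jet (p : P) (g : G) :
    B.jetAct ⟨p, Γ.jet p⟩ g = ⟨B.act p g, Γ.jet (B.act p g)⟩ := by
  refine congrArg (TotalSpace.mk (B.act p g)) (jetFiber_ext_jetProj (p := B.act p g)
    (ρ := (B.jetAct ⟨p, Γ.jet p⟩ g).snd) (Eq.trans ?_ (Γ.jetProj_jet (B.act p g)).symm))
  refine ContinuousLinearMap.ext fun (X : TangentSpace IP (B.act p g)) => ?_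
  obtain ⟨X, rfl⟩ := B.mfderiv_act_surjective p g X
  refine (jetProj_jetAct ⟨p, Γ.jet p⟩ g X).trans ?_
  rw [Γ.jetProj_jet]
  exact (Γ.equivariant p g X).symm

/-- Frees `sigma` from its chosen point: any `u` in the fibre computes the class. -/
theorem sigma_proj (u : P) : Γ.sigma (B.proj u) = B.toConn ⟨u, Γ.jet u⟩ := by
  -- The point chosen in `sigma` lies in the fibre of `u`, so some `g` moves it to `u`; the jet
  -- chosen there is `Γ.jet` by definition.
  obtain ⟨g, hg⟩ := (B.proj_eq_iff _ u).1 (B.proj_surjective (B.proj u)).choose_spec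
  refine Quotient.sound (s := B.jetSetoid) ⟨g, ?_⟩
  refine (Γ.jetAct_jet _ g).trans ?_
  rw [hg]

/-- The bijection `J¹P ≃ π^*P` sends `Γ.jet u` to `(σ_Γ(τ u), u)` by `sigma_proj`; this turns its
abstract inverse into an explicit formula. -/
theorem sigmaTilde_eq : Γ.sigmaTilde = fun u => ⟨u, Γ.jet u⟩ := by
  funext u
  refine (Equiv.symm_apply_eq _).2 (Subtype.ext (Prod.ext (Γ.sigma_proj u) rfl))

theorem jet_apply_proj (p : P) (X : TangentSpace IP p) :
    (Γ.jet p).1 (mfderiv IP IM B.proj p X) = X - Γ.toFun p X := by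
  rw [← Γ.jetProj_jet p]
  exact (sub_sub_cancel X _).symm

/-! ### Smoothness of the jet field and the pullback of the canonical form -/

variable [IsManifold IM ∞ M]

/-- The coordinate of the jet of a connection in a local trivialization. -/
theorem jetCoord_jet (t : B.LocalTriv) (x₀ : M) {q : P} (hq : B.proj q ∈ t.baseSet) (v : EM) :
    jetCoord t x₀ (Γ.jet q) v = -t.flatForm q (Γ.toFun q (t.flatLift q
      ((trivializationAt EM (TangentSpace IM) x₀).symmL ℝ (B.proj q) v))) := by
  set w : TangentSpace IM (B.proj q) :=
    (trivializationAt EM (TangentSpace IM) x₀).symmL ℝ (B.proj q) v with hw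
  -- The flat lift of `w` projects to `w`, so the jet sends `w` to this lift minus its `Γ`-part. The
  -- flat form kills the lift, which explains the sign.
  have h1 := Γ.jet_apply_proj q (t.flatLift q w)
  rw [t.proj_flatLift hq] at h1
  have h2 : t.flatForm q ((Γ.jet q).1 w) = -t.flatForm q (Γ.toFun q (t.flatLift q w)) := by
    rw [h1, map_sub, t.flatForm_flatLift hq, zero_sub]
  exact h2

theorem contMDiffAt_jetCoord_jet (t : B.LocalTriv) {p : P} (hp : B.proj p ∈ t.baseSet) :
    ContMDiffAt IP 𝓘(ℝ, EM →L[ℝ] EG) ∞ (fun q => jetCoord t (B.proj p) (Γ.jet q)) p := by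
  -- Smoothness of `Γ` as a section of the endomorphism bundle, read as a matrix in the tangent
  -- trivialization at `p`.
  have hΓ := ((contMDiffAt_hom_bundle _).1 (Γ.contMDiff_toFun p)).2
  have h := (((t.contMDiffAt_flatForm hp).clm_comp hΓ).clm_comp (t.contMDiffAt_flatLift hp)).neg
  refine h.congr_of_eventuallyEq ?_
  filter_upwards [t.nhds_base hp, (trivializationAt EP (TangentSpace IP) p).open_baseSet.mem_nhds
    (mem_baseSet_trivializationAt EP (TangentSpace IP) p)] with q hq hqp
  refine ContinuousLinearMap.ext fun v => ?_
  refine (Γ.jetCoord_jet t (B.proj p) hq v).trans ?_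
  -- The product of the three coordinate expressions contains two pairs of a trivialization and its
  -- inverse, one on each side of `Γ`; they cancel where the trivialization at `p` is defined.
  have hs : ∀ X : TangentSpace IP q, (trivializationAt EP (TangentSpace IP) p).symmL ℝ q
      ((trivializationAt EP (TangentSpace IP) p).continuousLinearMapAt ℝ q X) = X :=
    Trivialization.symmL_continuousLinearMapAt _ hqp
  set w : TangentSpace IM (B.proj q) :=
    (trivializationAt EM (TangentSpace IM) (B.proj p)).symmL ℝ (B.proj q) v
  have e : t.flatForm q (Γ.toFun q (t.flatLift q w)) =
      t.flatForm q ((trivializationAt EP (TangentSpace IP) p).symmL ℝ q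
      ((trivializationAt EP (TangentSpace IP) p).continuousLinearMapAt ℝ q
        (Γ.toFun q ((trivializationAt EP (TangentSpace IP) p).symmL ℝ q
      ((trivializationAt EP (TangentSpace IP) p).continuousLinearMapAt ℝ q
        (t.flatLift q w)))))) := by
    rw [hs, hs]
  exact congrArg Neg.neg e

/-- The base component is the identity, and the fibre component in the preferred trivialization of
`J¹P` at `p` is `jetCoord` for `B.trivAt (B.proj p)` and the chart at `B.proj p`. -/
theorem contMDiff_jet : ContMDiff IP (IP.prod 𝓘(ℝ, EM →L[ℝ] EG)) ∞
    (fun u => (⟨u, Γ.jet u⟩ : B.J1)) := fun p =>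
  contMDiffAt_totalSpace.2
    ⟨contMDiffAt_id, Γ.contMDiffAt_jetCoord_jet (B.trivAt (B.proj p)) (B.mem_trivAt _)⟩

theorem pullbackForm_jet :
    pullbackForm IP (IP.prod 𝓘(ℝ, EM →L[ℝ] EG)) (fun u => (⟨u, Γ.jet u⟩ : B.J1))
      B.canonicalForm = Γ.form := by
  funext u
  refine ContinuousLinearMap.ext fun X => ?_
  -- The chain rule for `τ₁₀ ∘ σ̃ = id`; differentiability of the jet field is needed here.
  have hd : mfderiv (IP.prod 𝓘(ℝ, EM →L[ℝ] EG)) IP B.tau10 ⟨u, Γ.jet u⟩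
      (mfderiv IP (IP.prod 𝓘(ℝ, EM →L[ℝ] EG)) (fun u => (⟨u, Γ.jet u⟩ : B.J1)) u X) = X := by
    have h := mfderiv_chain (I := IP) (J := IP.prod 𝓘(ℝ, EM →L[ℝ] EG)) (K := IP)
      (g := B.tau10) (k := id) (x := u) (z := u)
      (Γ.contMDiff_jet.mdifferentiable (by simp) u)
      ((Bundle.contMDiff_proj (IB := IP) (n := ∞) B.JetFiber).mdifferentiable (by simp) _) rfl rfl rfl
      (by rfl) X
    rw [mfderiv_id] at h
    exact h
  -- Both forms end with the same identification `V_u P ≃ 𝔤`, so it is enough to compare vertical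
  -- vectors.
  refine congrArg (B.vertEquiv u).symm (Subtype.ext ?_)
  refine Eq.trans (congrArg (jetProj (B := B) ⟨u, Γ.jet u⟩) hd) ?_
  exact DFunLike.congr_fun (Γ.jetProj_jet u) X

end Connection

end PrincipalBundle

theorem mainTheorem8 {EM HM EP HP EG HG : Type*}
    [NormedAddCommGroup EM] [NormedSpace ℝ EM] [TopologicalSpace HM]
    [NormedAddCommGroup EP] [NormedSpace ℝ EP] [TopologicalSpace HP]
    [NormedAddCommGroup EG] [NormedSpace ℝ EG] [TopologicalSpace HG]
    {IM : ModelWithCorners ℝ EM HM} {IP : ModelWithCorners ℝ EP HP}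
    {IG : ModelWithCorners ℝ EG HG}
    {M P G : Type*} [TopologicalSpace M] [ChartedSpace HM M] [IsManifold IM ∞ M]
    [TopologicalSpace P] [ChartedSpace HP P] [IsManifold IP ∞ P]
    [TopologicalSpace G] [ChartedSpace HG G] [Group G] [LieGroup IG ∞ G]
    (B : PrincipalBundle IM IP IG M P G) (Γ : B.Connection) :
    ContMDiff IP (IP.prod 𝓘(ℝ, EM →L[ℝ] EG)) ∞ Γ.sigmaTilde ∧
    (∀ u : P, B.tau10 (Γ.sigmaTilde u) = u) ∧
    pullbackForm IP (IP.prod 𝓘(ℝ, EM →L[ℝ] EG)) Γ.sigmaTilde B.canonicalForm = Γ.form := by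
  rw [Γ.sigmaTilde_eq]
  exact ⟨Γ.contMDiff_jet, fun _ => rfl, Γ.pullbackForm_jet⟩
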